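/- Let $\mathcal H=\mathcal H_1\otimes\mathcal H_2$ be the Hilbert space tensor product of complex Hilbert spaces $\mathcal H_1,\mathcal H_2$, with inner product $\langle\cdot,\cdot\rangle$ linear in the first variable, and let $(X,\mu)=(X_1\times X_2,\mu_1\otimes\mu_2)$ be the product of two $\sigma$-finite measure spaces. Let $F,G:X\to\mathcal H$ be Bessel mappings with Bessel bounds $B_F,B_G\in[0,\infty)$, i.e. for every $f\in\mathcal H$ the functions $x\mapsto\langle f,F(x)\rangle$ and $x\mapsto\langle f,G(x)\rangle$ are $\mu$-measurable and $$\int_X|\langle f,F(x)\rangle|^2\,d\mu(x)\le B_F\|f\|^2,\qquad \int_X|\langle f,G(x)\rangle|^2\,d\mu(x)\le B_G\|f\|^2 .$$ Assume that $F$ and $G$ are norm bounded: $\|F(x)\|\le L_F<\infty$ and $\|G(x)\|\le L_G<\infty$ for $\mu$-almost every $x\in X$. For $m:X\to\mathbb C$, the multiplier $\mathbf M_{m,F,G}:\mathcal H\to\mathcal H$ is defined weakly by $$\langle \mathbf M_{m,F,G}f,g\rangle=\int_X m(x)\,\langle f,F(x)\rangle\,\langle G(x),g\rangle\,d\mu(x)\qquad(f,g\in\mathcal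 H).$$ For $1\le p<\infty$, the Schatten class $\mathcal S_p(\mathcal H)$ is the set of compact operators $T$ on $\mathcal H$ whose singular values $(s_n)$ (the eigenvalues, counted with multiplicity, of the non-negative operator $S$ with $S^2=T^*T$) lie in $\ell^p$, and $\|T\|_{\mathcal S_p}=(\sum_n s_n^p)^{1/p}$; the elements of $\mathcal S_1(\mathcal H)$ are the trace class operators. Then: 1. If $m\in L^1(X,\mu)$, then $\mathbf M_{m,F,G}$ is a well-defined bounded operator (the integrand is integrable for all $f,g$, and exactly one map satisfies the weak definition), it is trace class, and $$\|\mathbf M_{m,F,G}\|_{\mathcal S_1}\le\|m\|_1\,L_F\,L_G .$$ 2. If $m\in L^p(X,\mu)$ with $1<p<\infty$, then $\mathbf M_{m,F,G}$ is, in the same sense, a well-defined bounded operator, it belongs to $\mathcal S_p(\mathcal H)$, and $$\|\mathbf M_{m,F,G}\|_{\mathcal S_p}\le\|m\|_p\,(L_FL_G)^{1/p}\,(B_FB_G)^{\frac{p-1}{2p}} .$$ -/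

import Mathlib

open MeasureTheory
open scoped ENNReal NNReal TensorProduct

noncomputable section

/-- The Hilbert space tensor product of two complex Hilbert spaces: the completion of the algebraic
tensor product for the inner product with
`⟪x₁ ⊗ y₁, x₂ ⊗ y₂⟫ = ⟪x₁, x₂⟫ * ⟪y₁, y₂⟫`. -/
abbrev HilbertTensor (H₁ H₂ : Type*)
    [NormedAddCommGroup H₁] [InnerProductSpace ℂ H₁]
    [NormedAddCommGroup H₂] [InnerProductSpace ℂ H₂] : Type _ :=
  UniformSpace.Completion (H₁ ⊗[ℂ] H₂)

section Schatten

variable {H : Type*} [NormedAddCommGroup H] [InnerProductSpace ℂ H] [CompleteSpace H]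

/-- The multiplicity of `s` as a singular value of `T`: the dimension of the eigenspace, for the
eigenvalue `s`, of the non-negative operator `CFC.abs T` whose square is `T* T`. -/
def singularMultiplicity (T : H →L[ℂ] H) (s : ℝ) : ℕ∞ :=
  Cardinal.toENat (Module.rank ℂ
    (Module.End.eigenspace (CFC.abs T : H →L[ℂ] H).toLinearMap (s : ℂ)))

/-- The `ℓ^p` norm, in `[0, ∞]`, of the family of the singular values of `T`, each repeated
according to its multiplicity (the singular value `0` contributes nothing).
For a compact operator `T` this is its Schatten `p`-norm. -/
def schattenNorm (p : ℝ) (T : H →L[ℂ] H) : ℝ≥0∞ :=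
  (∑' s : Set.Ioi (0 : ℝ), (singularMultiplicity T s : ℝ≥0∞) * ENNReal.ofReal s ^ p) ^ (1 / p)

/-- `T` belongs to the Schatten class `S_p`: it is compact and the family of its singular values
is in `ℓ^p`. -/
def MemSchatten (p : ℝ) (T : H →L[ℂ] H) : Prop :=
  IsCompactOperator T ∧ schattenNorm p T < ∞

/-- The trace class operators, that is, the Schatten class `S_1`. -/
def IsTraceClass (T : H →L[ℂ] H) : Prop := MemSchatten 1 T

end Schatten

section Multiplier

variable {X H : Type*} [MeasurableSpace X] [NormedAddCommGroup H] [InnerProductSpace ℂ H]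

/- Mathlib's inner product is linear in the second argument: the scalar `⟨f, F x⟩` of a
product that is linear in the first argument is `inner ℂ (F x) f`. -/

/-- `F` is a Bessel mapping with respect to `(X, μ)`, with Bessel bound `B`: it is weakly
`μ`-measurable and `∫ |⟨f, F x⟩|² dμ(x) ≤ B ‖f‖²` for all `f`. -/
structure IsBesselMap (μ : Measure X) (F : X → H) (B : ℝ≥0) : Prop where
  aemeasurable : ∀ f : H, AEMeasurable (fun x => inner ℂ (F x) f) μ
  bound : ∀ f : H, ∫⁻ x, ‖inner ℂ (F x) f‖ₑ ^ 2 ∂μ ≤ (B : ℝ≥0∞) * ‖f‖ₑ ^ 2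

/-- `F` is norm bounded on `(X, μ)` with norm bound `L`. -/
def IsNormBounded (μ : Measure X) (F : X → H) (L : ℝ≥0) : Prop :=
  ∀ᵐ x ∂μ, ‖F x‖ ≤ L

/-- The map `M : H → H` satisfies the weak definition of the multiplier of `F` and `G` with
symbol `m`: for all `f` and `g` the function `m(x) ⟨f, F x⟩ ⟨G x, g⟩` is integrable, and its
integral is `⟨M f, g⟩`. -/
structure IsMultiplier (μ : Measure X) (m : X → ℂ) (F G : X → H) (M : H → H) : Prop where
  integrable : ∀ f g : H, Integrable (fun x => m x * inner ℂ (F x) f * inner ℂ g (G x)) μ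
  inner_eq : ∀ f g : H, inner ℂ g (M f) = ∫ x, m x * inner ℂ (F x) f * inner ℂ g (G x) ∂μ

end Multiplier

end

/-! ### Compactness and Schatten norms from orthonormal diagonals. -/

section SchattenCriterion

variable {H : Type*} [NormedAddCommGroup H] [InnerProductSpace ℂ H]

/-! No interpolation between p = 1 and p = ∞ is needed: everything is read off the diagonals ⟨M eᵢ,
fᵢ⟩ along finite orthonormal families. If their ℓ^p norms are at most K, then M is compact and
‖M‖_{S_p} ≤ K (`schattenNorm_le_of_sum_enorm_inner_rpow_le`), because eigenvectors eᵢ of |M| with fᵢ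
= M eᵢ / sᵢ have the singular values as diagonal. For the multiplier put wᵢ(x) = |⟨eᵢ, F x⟩ ⟨G x,
fᵢ⟩|. Hölder with weight wᵢ gives |⟨M eᵢ, fᵢ⟩|^p ≤ (∫ |m|^p wᵢ) (∫ wᵢ)^(p-1). The Bessel bounds give
∫ wᵢ ≤ (B_F B_G)^(1/2), and Bessel's inequality in H gives ∑ wᵢ(x) ≤ ‖F x‖ ‖G x‖ ≤ L_F L_G
(`sum_rpow_lintegral_symbol_le`). -/

/-- Finite orthonormal families along which the diagonal of `T` stays above `ε` and which cannot be
prolonged leave a small corner of `T` on their orthogonal complements. -/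
theorem norm_inner_le_of_maximal_orthonormal {T : H →L[ℂ] H} {ε : ℝ} {n : ℕ}
    {e f : Fin n → H} (he : Orthonormal ℂ e) (hf : Orthonormal ℂ f)
    (hef : ∀ i, ε ≤ ‖inner ℂ (f i) (T (e i))‖)
    (hmax : ¬ ∃ e' f' : Fin (n + 1) → H, Orthonormal ℂ e' ∧ Orthonormal ℂ f' ∧
      ∀ i, ε ≤ ‖inner ℂ (f' i) (T (e' i))‖)
    {u v : H} (hu : ∀ i, inner ℂ u (e i) = 0) (hv : ∀ i, inner ℂ v (f i) = 0) :
    ‖inner ℂ v (T u)‖ ≤ ε * ‖v‖ * ‖u‖ := by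
  rcases eq_or_ne u 0 with rfl | hu0
  · simp
  rcases eq_or_ne v 0 with rfl | hv0
  · simp
  by_contra! hlt
  have hun : 0 < ‖u‖ := norm_pos_iff.2 hu0
  have hvn : 0 < ‖v‖ := norm_pos_iff.2 hv0
  -- Otherwise the normalized `u` and `v` prolong both families by one entry above `ε`.
  refine hmax ⟨Matrix.vecCons ((‖u‖⁻¹ : ℂ) • u) e, Matrix.vecCons ((‖v‖⁻¹ : ℂ) • v) f,
    orthonormal_vecCons_iff.2 ⟨norm_smul_inv_norm hu0, fun i => ?_, he⟩,
    orthonormal_vecCons_iff.2 ⟨norm_smul_inv_norm hv0, fun i => ?_, hf⟩, fun i => ?_⟩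
  · simp [inner_smul_left, hu i]
  · simp [inner_smul_left, hv i]
  · refine Fin.cases ?_ (fun j => ?_) i
    · simp only [Matrix.cons_val_zero, map_smul, inner_smul_left, inner_smul_right, norm_mul]
      simp only [map_inv₀, Complex.conj_ofReal, norm_inv, Complex.norm_real, norm_norm]
      rw [← mul_assoc, ← mul_inv, inv_mul_eq_div, le_div_iff₀ (by positivity)]
      nlinarith
    · simpa using hef j

/-- An operator whose diagonals along pairs of finite orthonormal families have only boundedly many
entries above each positive level is compact. -/
theorem isCompactOperator_of_bounded_orthonormal_length [CompleteSpace H] {T : H →L[ℂ] H}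
    (h : ∀ ε : ℝ, 0 < ε → ∃ N : ℕ, ∀ n : ℕ, ∀ e f : Fin n → H,
      Orthonormal ℂ e → Orthonormal ℂ f → (∀ i, ε ≤ ‖inner ℂ (f i) (T (e i))‖) → n ≤ N) :
    IsCompactOperator T := by
  -- Compact operators are norm closed, so a compact `R` within `ε` of `T` suffices; level `ε / 2`
  -- makes the inequality strict.
  refine isClosed_setOfPred_isCompactOperator.closure_subset
    (Metric.mem_closure_iff.2 fun ε hε => ?_)
  let P : ℕ → Prop := fun n => ∃ e f : Fin n → H, Orthonormal ℂ e ∧ Orthonormal ℂ f ∧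
      ∀ i, ε / 2 ≤ ‖inner ℂ (f i) (T (e i))‖
  obtain ⟨N, hN⟩ := h (ε / 2) (half_pos hε)
  have hP0 : P 0 := ⟨Fin.elim0, Fin.elim0, ⟨fun i => i.elim0, fun i => i.elim0⟩,
    ⟨fun i => i.elim0, fun i => i.elim0⟩, fun i => i.elim0⟩
  have hlast : ∃ n, P n ∧ ¬ P (n + 1) := by
    by_contra! hcon
    have hall : ∀ n, P n := fun n => Nat.rec hP0 (fun k hk => hcon k hk) n
    obtain ⟨e, f, he, hf, hef⟩ := hall (N + 1)
    exact absurd (hN _ e f he hf hef) (by omega)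
  obtain ⟨n, ⟨e, f, he, hf, hef⟩, hmax⟩ := hlast
  let E : Submodule ℂ H := Submodule.span ℂ (Set.range e)
  let V : Submodule ℂ H := Submodule.span ℂ (Set.range f)
  have : FiniteDimensional ℂ E := FiniteDimensional.span_of_finite ℂ (Set.finite_range e)
  have : FiniteDimensional ℂ V := FiniteDimensional.span_of_finite ℂ (Set.finite_range f)
  have hcE : IsCompactOperator E.starProjection :=
    (isCompactOperator_of_locallyCompactSpace_rng E.subtypeL).comp_clm E.orthogonalProjectionOnto
  have hcV : IsCompactOperator V.starProjection :=
    (isCompactOperator_of_locallyCompactSpace_rng V.subtypeL).comp_clm V.orthogonalProjectionOnto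
  -- Each summand contains a finite-rank projection, and `T - R` is the corner (1 - P_V) T (1 -
  -- P_E).
  let R : H →L[ℂ] H :=
    T ∘L E.starProjection + V.starProjection ∘L (T ∘L (1 - E.starProjection))
  refine ⟨R, (hcE.clm_comp T).add (hcV.comp_clm (T ∘L (1 - E.starProjection))), ?_⟩
  rw [dist_eq_norm]
  refine lt_of_le_of_lt (ContinuousLinearMap.opNorm_le_bound _ (half_pos hε).le fun x => ?_)
    (half_lt_self hε)
  have hu : ∀ i, inner ℂ (x - E.starProjection x) (e i) = 0 := fun i =>
    Submodule.inner_left_of_mem_orthogonal (K := E) (Submodule.subset_span (Set.mem_range_self i))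
      (E.sub_starProjection_mem_orthogonal x)
  set u := x - E.starProjection x with hu_def
  have hv : ∀ i, inner ℂ (T u - V.starProjection (T u)) (f i) = 0 := fun i =>
    Submodule.inner_left_of_mem_orthogonal (K := V) (Submodule.subset_span (Set.mem_range_self i))
      (V.sub_starProjection_mem_orthogonal (T u))
  set v := T u - V.starProjection (T u) with hv_def
  have hval : (T - R) x = v := by
    simp [R, hv_def, hu_def, sub_sub]
  rw [hval]
  -- `v` is a projection of `T u`, so the corner estimate tested against `v` bounds ‖v‖² and hence
  -- ‖v‖.
  have hvv : inner ℂ v (T u) = inner ℂ v v := by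
    have h0 : inner ℂ v (V.starProjection (T u)) = 0 :=
      Submodule.inner_left_of_mem_orthogonal (Submodule.starProjection_apply_mem _ _)
        (V.sub_starProjection_mem_orthogonal (T u))
    conv_rhs => rw [hv_def, inner_sub_right, ← hv_def, h0, sub_zero]
  have hle := norm_inner_le_of_maximal_orthonormal he hf hef hmax hu hv
  rw [hvv, inner_self_eq_norm_sq_to_K] at hle
  have hux : ‖u‖ ≤ ‖x‖ := by
    have := Eᗮ.norm_starProjection_apply_le x
    rwa [Submodule.starProjection_orthogonal_val] at this
  rcases eq_or_lt_of_le (norm_nonneg v) with h0 | hpos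
  · rw [← h0]; positivity
  · have h1 : ‖v‖ * ‖v‖ ≤ (ε / 2 * ‖u‖) * ‖v‖ := by
      simp only [norm_pow, Complex.coe_algebraMap, Complex.norm_real, norm_norm] at hle
      nlinarith
    exact (le_of_mul_le_mul_right h1 hpos).trans (by gcongr)

/-- An operator is compact when the `ℓ^p` norms of its diagonals along pairs of finite orthonormal
families are bounded. -/
theorem isCompactOperator_of_sum_enorm_inner_rpow_le [CompleteSpace H] {T : H →L[ℂ] H} {p : ℝ}
    (hp : 0 < p) {K : ℝ≥0∞} (hK : K ≠ ∞)
    (h : ∀ (ι : Type) [Fintype ι] (e f : ι → H), Orthonormal ℂ e → Orthonormal ℂ f →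
      ∑ i, ‖inner ℂ (f i) (T (e i))‖ₑ ^ p ≤ K ^ p) :
    IsCompactOperator T := by
  refine isCompactOperator_of_bounded_orthonormal_length fun ε hε => ?_
  have hε0 : ENNReal.ofReal ε ^ p ≠ 0 := by
    simp [ENNReal.rpow_eq_zero_iff, hε, hp.not_gt]
  obtain ⟨N, hN⟩ := ENNReal.exists_nat_mul_gt hε0 (ENNReal.rpow_ne_top_of_nonneg hp.le hK)
  refine ⟨N, fun n e f he hf hef => ?_⟩
  by_contra! hn
  have h1 : (n : ℝ≥0∞) * ENNReal.ofReal ε ^ p ≤ K ^ p := by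
    calc (n : ℝ≥0∞) * ENNReal.ofReal ε ^ p = ∑ _i : Fin n, ENNReal.ofReal ε ^ p := by simp
      _ ≤ ∑ i, ‖inner ℂ (f i) (T (e i))‖ₑ ^ p := by
        refine Finset.sum_le_sum fun i _ => ENNReal.rpow_le_rpow ?_ hp.le
        rw [← ofReal_norm]
        exact ENNReal.ofReal_le_ofReal (hef i)
      _ ≤ K ^ p := h (Fin n) e f he hf
  refine absurd (hN.trans_le (le_trans ?_ h1)) (lt_irrefl _)
  gcongr

variable [CompleteSpace H]

/-- `T` maps orthonormal eigenvectors of `CFC.abs T`, for non-zero eigenvalues, to orthogonal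
vectors whose norms are the eigenvalues. -/
theorem inner_apply_apply_of_abs_apply {T : H →L[ℂ] H} {x y : H} {s t : ℝ}
    (hx : CFC.abs T x = (s : ℂ) • x) (hy : CFC.abs T y = (t : ℂ) • y) :
    inner ℂ (T x) (T y) = (s * t : ℂ) * inner ℂ x y := by
  have hsa : IsSelfAdjoint (CFC.abs T) := CFC.abs_nonneg T |>.isSelfAdjoint
  have h1 : inner ℂ (T x) (T y) = inner ℂ x ((star T * T) y) := by
    simp [ContinuousLinearMap.star_eq_adjoint, ContinuousLinearMap.adjoint_inner_right]
  rw [h1, ← CFC.abs_mul_abs, mul_apply_eq_comp,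
    ← ContinuousLinearMap.adjoint_inner_left, hsa.adjoint_eq, hx, hy, inner_smul_left,
    inner_smul_right, Complex.conj_ofReal, mul_assoc]

/-- The eigenspaces of `CFC.abs T` hold orthonormal families of every finite length up to the
multiplicity. -/
theorem exists_orthonormal_of_le_singularMultiplicity {T : H →L[ℂ] H} {s : ℝ} {n : ℕ}
    (hn : (n : ℕ∞) ≤ singularMultiplicity T s) :
    ∃ v : Fin n → Module.End.eigenspace (CFC.abs T : H →L[ℂ] H).toLinearMap (s : ℂ),
      Orthonormal ℂ v := by
  have h1 : (n : Cardinal) ≤ Module.rank ℂ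
      (Module.End.eigenspace (CFC.abs T : H →L[ℂ] H).toLinearMap (s : ℂ)) := by
    have := Cardinal.enat_gc.l_le (a := (n : ℕ∞)) hn
    simpa using this
  obtain ⟨v, hv⟩ := Module.le_rank_iff.1 h1
  exact ⟨_, InnerProductSpace.gramSchmidtNormed_orthonormal hv⟩

/-- Finite partial sums of the `p`-th powers of the singular values are bounded by the diagonals
along orthonormal families. -/
theorem sum_singular_rpow_le {T : H →L[ℂ] H} {p : ℝ} {K : ℝ≥0∞}
    (h : ∀ (ι : Type) [Fintype ι] (e f : ι → H), Orthonormal ℂ e → Orthonormal ℂ f →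
      ∑ i, ‖inner ℂ (f i) (T (e i))‖ₑ ^ p ≤ K ^ p)
    (S : Finset (Set.Ioi (0 : ℝ))) (n : Set.Ioi (0 : ℝ) → ℕ)
    (hn : ∀ s ∈ S, (n s : ℕ∞) ≤ singularMultiplicity T s) :
    ∑ s ∈ S, (n s : ℝ≥0∞) * ENNReal.ofReal s ^ p ≤ K ^ p := by
  choose v hv using fun s : S => exists_orthonormal_of_le_singularMultiplicity (hn s s.2)
  have hsa : IsSelfAdjoint (CFC.abs T) := CFC.abs_nonneg T |>.isSelfAdjoint
  have hfam : OrthogonalFamily ℂ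
      (fun s : S => Module.End.eigenspace (CFC.abs T : H →L[ℂ] H).toLinearMap ((s : ℝ) : ℂ))
      fun s => (Module.End.eigenspace (CFC.abs T : H →L[ℂ] H).toLinearMap
        ((s : ℝ) : ℂ)).subtypeₗᵢ :=
    hsa.isSymmetric.orthogonalFamily_eigenspaces.comp (γ := S) (f := fun s => ((s : ℝ) : ℂ))
      fun a b hab => Subtype.ext (Subtype.ext (Complex.ofReal_injective hab))
  have he := hfam.orthonormal_sigma_orthonormal hv
  set e : (Σ s : S, Fin (n s)) → H := fun a => (v a.1 a.2 : H)
  have heig : ∀ a, CFC.abs T (e a) = (((a.1 : Set.Ioi (0 : ℝ)) : ℝ) : ℂ) • e a := fun a =>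
    Module.End.mem_eigenspace_iff.1 (v a.1 a.2).2
  have he' : Orthonormal ℂ e := he
  have hpos : ∀ a : (Σ s : S, Fin (n s)), (((a.1 : Set.Ioi (0 : ℝ)) : ℝ) : ℂ) ≠ 0 := fun a =>
    Complex.ofReal_ne_zero.2 (ne_of_gt a.1.1.2)
  -- The image of `e` under the partial isometry of the polar decomposition of `T`.
  let f : (Σ s : S, Fin (n s)) → H := fun a => (((a.1 : Set.Ioi (0 : ℝ)) : ℝ) : ℂ)⁻¹ • T (e a)
  have hf : Orthonormal ℂ f := by
    classical
    rw [orthonormal_iff_ite] at he' ⊢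
    intro a b
    simp only [f, inner_smul_left, inner_smul_right,
      inner_apply_apply_of_abs_apply (heig a) (heig b), he' a b, map_inv₀, Complex.conj_ofReal]
    have := hpos a
    have := hpos b
    split_ifs
    · field_simp
    · simp
  have hdiag : ∀ a, inner ℂ (f a) (T (e a)) = (((a.1 : Set.Ioi (0 : ℝ)) : ℝ) : ℂ) := by
    intro a
    simp only [f, inner_smul_left, inner_apply_apply_of_abs_apply (heig a) (heig a),
      inner_self_eq_norm_sq_to_K, he'.1 a, map_inv₀, Complex.conj_ofReal]
    simp [inv_mul_cancel_left₀ (hpos a)]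
  have hsum := h _ e f he' hf
  simp only [hdiag] at hsum
  rw [Fintype.sum_sigma] at hsum
  refine le_trans (le_of_eq ?_) hsum
  rw [← Finset.sum_coe_sort S]
  refine Finset.sum_congr rfl fun s _ => ?_
  have hs : ‖(((s : Set.Ioi (0 : ℝ)) : ℝ) : ℂ)‖ₑ = ENNReal.ofReal ((s : Set.Ioi (0 : ℝ)) : ℝ) := by
    rw [← ofReal_norm, Complex.norm_real, Real.norm_of_nonneg (le_of_lt s.1.2)]
  simp [hs]

/-- The Schatten norm is at most every bound on the `ℓ^p` norms of the diagonals along pairs of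
finite orthonormal families. -/
theorem schattenNorm_le_of_sum_enorm_inner_rpow_le {T : H →L[ℂ] H} {p : ℝ}
    (hp : 0 < p) {K : ℝ≥0∞} (hK : K ≠ ∞)
    (h : ∀ (ι : Type) [Fintype ι] (e f : ι → H), Orthonormal ℂ e → Orthonormal ℂ f →
      ∑ i, ‖inner ℂ (f i) (T (e i))‖ₑ ^ p ≤ K ^ p) :
    schattenNorm p T ≤ K := by
  -- An infinite multiplicity would allow N copies of s^p with N s^p > K^p; finiteness makes `toNat`
  -- lossless below.
  have hfin : ∀ s : Set.Ioi (0 : ℝ), singularMultiplicity T s ≠ ⊤ := by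
    intro s hs
    have hs0 : ENNReal.ofReal (s : ℝ) ^ p ≠ 0 := by
      have : (0 : ℝ) < s := s.2
      simp [ENNReal.rpow_eq_zero_iff, this, hp.not_gt]
    obtain ⟨N, hN⟩ := ENNReal.exists_nat_mul_gt hs0 (ENNReal.rpow_ne_top_of_nonneg hp.le hK)
    have := sum_singular_rpow_le h {s} (fun _ => N) (by simp [hs])
    rw [Finset.sum_singleton] at this
    exact absurd (hN.trans_le this) (lt_irrefl _)
  have hsum : ∑' s : Set.Ioi (0 : ℝ),
      (singularMultiplicity T s : ℝ≥0∞) * ENNReal.ofReal s ^ p ≤ K ^ p := by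
    rw [ENNReal.tsum_eq_iSup_sum]
    refine iSup_le fun S => ?_
    have hc : ∀ s : Set.Ioi (0 : ℝ), (((singularMultiplicity T s).toNat : ℕ) : ℕ∞)
        = singularMultiplicity T s := fun s => ENat.natCast_toNat (hfin s)
    refine le_trans (le_of_eq (Finset.sum_congr rfl fun s _ => ?_)) (sum_singular_rpow_le h S
      (fun s => (singularMultiplicity T s).toNat) fun s _ => (hc s).le)
    conv_lhs => rw [← hc s]
    simp
  calc schattenNorm p T ≤ (K ^ p) ^ (1 / p) := ENNReal.rpow_le_rpow hsum (by positivity)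
    _ = K := by rw [one_div, ENNReal.rpow_rpow_inv hp.ne']

end SchattenCriterion

/-! ### Hölder's inequality with a weight. -/

section HoelderWeight

variable {X : Type*} [MeasurableSpace X] {μ : Measure X}

/-- Hölder's inequality for the product of a function with a weight. -/
theorem lintegral_mul_weight_rpow_le {m w : X → ℝ≥0∞} (hm : AEMeasurable m μ)
    (hw : AEMeasurable w μ) {p : ℝ} (hp : 1 ≤ p) :
    (∫⁻ x, m x * w x ∂μ) ^ p ≤ (∫⁻ x, m x ^ p * w x ∂μ) * (∫⁻ x, w x ∂μ) ^ (p - 1) := by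
  have hp0 : 0 < p := by linarith
  have hq : 0 ≤ 1 - 1 / p := by
    rw [sub_nonneg, div_le_one hp0]; exact hp
  have h1 : ∫⁻ x, m x * w x ∂μ ≤
      (∫⁻ x, m x ^ p * w x ∂μ) ^ (1 / p) * (∫⁻ x, w x ∂μ) ^ (1 - 1 / p) := by
    -- Splits m w as (m^p w)^(1/p) · w^(1 - 1/p).
    refine le_trans (le_of_eq (lintegral_congr fun x => ?_))
      (ENNReal.lintegral_mul_norm_pow_le ((hm.pow_const p).mul hw) hw
        (by positivity : 0 ≤ 1 / p) hq (by ring))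
    simp only [Pi.mul_apply]
    rw [ENNReal.mul_rpow_of_nonneg _ _ (by positivity), mul_assoc,
      ← ENNReal.rpow_add_of_nonneg _ _ (by positivity) hq, ← ENNReal.rpow_mul,
      mul_one_div_cancel hp0.ne']
    simp
  calc _ ≤ ((∫⁻ x, m x ^ p * w x ∂μ) ^ (1 / p) * (∫⁻ x, w x ∂μ) ^ (1 - 1 / p)) ^ p :=
        ENNReal.rpow_le_rpow h1 hp0.le
    _ = _ := by
        rw [ENNReal.mul_rpow_of_nonneg _ _ hp0.le, ← ENNReal.rpow_mul, ← ENNReal.rpow_mul,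
          one_div_mul_cancel hp0.ne', ENNReal.rpow_one, sub_mul, one_div_mul_cancel hp0.ne',
          one_mul]

end HoelderWeight

/-! ### Existence and Schatten bounds of Bessel multipliers. -/

section BesselMultiplier

variable {X H : Type*} [MeasurableSpace X] {μ : Measure X} [NormedAddCommGroup H]
  [InnerProductSpace ℂ H] {F G : X → H} {B_F B_G L_F L_G : ℝ≥0}

theorem IsBesselMap.aemeasurable_inner_left (hG : IsBesselMap μ G B_G) (g : H) :
    AEMeasurable (fun x => inner ℂ g (G x)) μ := by
  simpa only [Function.comp_def, inner_conj_symm] using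
    (Complex.continuous_conj.measurable.comp_aemeasurable (hG.aemeasurable g))

theorem aemeasurable_weight (hF : IsBesselMap μ F B_F) (hG : IsBesselMap μ G B_G) (f g : H) :
    AEMeasurable (fun x => ‖inner ℂ (F x) f‖ₑ * ‖inner ℂ g (G x)‖ₑ) μ :=
  (hF.aemeasurable f).enorm.mul (hG.aemeasurable_inner_left g).enorm

theorem enorm_inner_symm (x y : H) : ‖inner ℂ x y‖ₑ = ‖inner ℂ y x‖ₑ := by
  rw [← ofReal_norm, ← ofReal_norm, norm_inner_symm]

theorem enorm_inner_le (x y : H) : ‖inner ℂ x y‖ₑ ≤ ‖x‖ₑ * ‖y‖ₑ := by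
  rw [← ofReal_norm, ← ofReal_norm, ← ofReal_norm, ← ENNReal.ofReal_mul (norm_nonneg _)]
  exact ENNReal.ofReal_le_ofReal (norm_inner_le_norm x y)

/-- The Cauchy–Schwarz bound for the coefficients of two Bessel mappings. -/
theorem lintegral_enorm_inner_mul_le (hF : IsBesselMap μ F B_F) (hG : IsBesselMap μ G B_G)
    (f g : H) :
    ∫⁻ x, ‖inner ℂ (F x) f‖ₑ * ‖inner ℂ g (G x)‖ₑ ∂μ ≤
      ((B_F : ℝ≥0∞) * B_G) ^ (1 / 2 : ℝ) * (‖f‖ₑ * ‖g‖ₑ) := by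
  have hsq : ∀ t : ℝ≥0∞, (t ^ 2) ^ (1 / 2 : ℝ) = t := fun t => by
    rw [← ENNReal.rpow_natCast, ← ENNReal.rpow_mul]; norm_num
  calc _ = ∫⁻ x, (‖inner ℂ (F x) f‖ₑ ^ 2) ^ (1 / 2 : ℝ) *
          (‖inner ℂ (G x) g‖ₑ ^ 2) ^ (1 / 2 : ℝ) ∂μ := by
        simp only [hsq, enorm_inner_symm g]
    _ ≤ (∫⁻ x, ‖inner ℂ (F x) f‖ₑ ^ 2 ∂μ) ^ (1 / 2 : ℝ) *
          (∫⁻ x, ‖inner ℂ (G x) g‖ₑ ^ 2 ∂μ) ^ (1 / 2 : ℝ) :=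
        ENNReal.lintegral_mul_norm_pow_le ((hF.aemeasurable f).enorm.pow_const 2)
          ((hG.aemeasurable g).enorm.pow_const 2) (by norm_num) (by norm_num) (by norm_num)
    _ ≤ ((B_F : ℝ≥0∞) * ‖f‖ₑ ^ 2) ^ (1 / 2 : ℝ) * ((B_G : ℝ≥0∞) * ‖g‖ₑ ^ 2) ^ (1 / 2 : ℝ) := by
        gcongr
        · exact hF.bound f
        · exact hG.bound g
    _ = _ := by
        simp only [ENNReal.mul_rpow_of_nonneg _ _ (by norm_num : (0 : ℝ) ≤ 1 / 2), hsq]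
        ring

/-- Cauchy–Schwarz and Bessel's inequality for the coefficients of two vectors along finite
orthonormal families. -/
theorem Orthonormal.sum_enorm_inner_mul_le {ι : Type*} [Fintype ι] {e f : ι → H}
    (he : Orthonormal ℂ e) (hf : Orthonormal ℂ f) (x y : H) :
    ∑ i, ‖inner ℂ x (e i)‖ₑ * ‖inner ℂ (f i) y‖ₑ ≤ ‖x‖ₑ * ‖y‖ₑ := by
  have h : ∑ i, ‖inner ℂ x (e i)‖ * ‖inner ℂ (f i) y‖ ≤ ‖x‖ * ‖y‖ := by
    refine (Real.sum_mul_le_sqrt_mul_sqrt _ _ _).trans ?_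
    gcongr
    · refine Real.sqrt_le_iff.2 ⟨norm_nonneg _, ?_⟩
      simpa only [norm_inner_symm x] using he.sum_inner_products_le x (s := Finset.univ)
    · exact Real.sqrt_le_iff.2 ⟨norm_nonneg _, hf.sum_inner_products_le y (s := Finset.univ)⟩
  simp only [← ofReal_norm]
  simp only [← ENNReal.ofReal_mul (norm_nonneg _)]
  rw [← ENNReal.ofReal_sum_of_nonneg fun i _ => by positivity]
  exact ENNReal.ofReal_le_ofReal h

variable {m : X → ℂ} {p : ℝ}

/-- The bound for the Schatten `p`-norm of the multiplier with symbol `m`. -/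
noncomputable def multiplierBound (μ : Measure X) (m : X → ℂ) (p : ℝ) (B_F B_G L_F L_G : ℝ≥0) :
    ℝ≥0∞ :=
  eLpNorm m (ENNReal.ofReal p) μ * ((L_F : ℝ≥0∞) * (L_G : ℝ≥0∞)) ^ (1 / p) *
    ((B_F : ℝ≥0∞) * (B_G : ℝ≥0∞)) ^ ((p - 1) / (2 * p))

theorem multiplierBound_ne_top (hp : 1 ≤ p) (hm : MemLp m (ENNReal.ofReal p) μ) :
    multiplierBound μ m p B_F B_G L_F L_G ≠ ∞ := by
  have h1 : 0 ≤ (p - 1) / (2 * p) := div_nonneg (by linarith) (by linarith)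
  have h2 : 0 ≤ 1 / p := by positivity
  refine ENNReal.mul_ne_top (ENNReal.mul_ne_top hm.eLpNorm_ne_top ?_) ?_
  · exact ENNReal.rpow_ne_top_of_nonneg h2 (ENNReal.mul_ne_top ENNReal.coe_ne_top
      ENNReal.coe_ne_top)
  · exact ENNReal.rpow_ne_top_of_nonneg h1 (ENNReal.mul_ne_top ENNReal.coe_ne_top
      ENNReal.coe_ne_top)

theorem multiplierBound_rpow (hp : 1 ≤ p) :
    multiplierBound μ m p B_F B_G L_F L_G ^ p =
      (∫⁻ x, ‖m x‖ₑ ^ p ∂μ) * ((L_F : ℝ≥0∞) * L_G) *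
        (((B_F : ℝ≥0∞) * B_G) ^ (1 / 2 : ℝ)) ^ (p - 1) := by
  have hp0 : 0 < p := by linarith
  rw [multiplierBound, eLpNorm_eq_lintegral_rpow_enorm_toReal (by simpa using hp0)
    ENNReal.ofReal_ne_top, ENNReal.toReal_ofReal hp0.le,
    ENNReal.mul_rpow_of_nonneg _ _ hp0.le, ENNReal.mul_rpow_of_nonneg _ _ hp0.le]
  simp only [← ENNReal.rpow_mul]
  rw [one_div_mul_cancel hp0.ne', ENNReal.rpow_one, ENNReal.rpow_one]
  congr 2
  field_simp

theorem rpow_lintegral_symbol_le (hF : IsBesselMap μ F B_F) (hG : IsBesselMap μ G B_G)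
    (hp : 1 ≤ p) (hm : AEStronglyMeasurable m μ) (f g : H) :
    (∫⁻ x, ‖m x‖ₑ * (‖inner ℂ (F x) f‖ₑ * ‖inner ℂ g (G x)‖ₑ) ∂μ) ^ p ≤
      (∫⁻ x, ‖m x‖ₑ ^ p * (‖inner ℂ (F x) f‖ₑ * ‖inner ℂ g (G x)‖ₑ) ∂μ) *
        (((B_F : ℝ≥0∞) * B_G) ^ (1 / 2 : ℝ) * (‖f‖ₑ * ‖g‖ₑ)) ^ (p - 1) := by
  refine (lintegral_mul_weight_rpow_le hm.enorm (aemeasurable_weight hF hG f g) hp).trans ?_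
  gcongr
  exact lintegral_enorm_inner_mul_le hF hG f g

/-- Norm bounds control the weight next to |m|^p, Bessel bounds control the other factor. This
yields both integrability and boundedness of the sesquilinear form. -/
theorem lintegral_symbol_le (hF : IsBesselMap μ F B_F) (hG : IsBesselMap μ G B_G)
    (hLF : IsNormBounded μ F L_F) (hLG : IsNormBounded μ G L_G)
    (hp : 1 ≤ p) (hm : AEStronglyMeasurable m μ) (f g : H) :
    ∫⁻ x, ‖m x‖ₑ * (‖inner ℂ (F x) f‖ₑ * ‖inner ℂ g (G x)‖ₑ) ∂μ ≤
      multiplierBound μ m p B_F B_G L_F L_G * (‖f‖ₑ * ‖g‖ₑ) := by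
  have hp0 : 0 < p := by linarith
  rw [← ENNReal.rpow_le_rpow_iff hp0]
  refine (rpow_lintegral_symbol_le hF hG hp hm f g).trans ?_
  have h1 : ∫⁻ x, ‖m x‖ₑ ^ p * (‖inner ℂ (F x) f‖ₑ * ‖inner ℂ g (G x)‖ₑ) ∂μ ≤
      (∫⁻ x, ‖m x‖ₑ ^ p ∂μ) * (((L_F : ℝ≥0∞) * L_G) * (‖f‖ₑ * ‖g‖ₑ)) := by
    rw [← lintegral_mul_const'' _ (hm.enorm.pow_const p)]
    refine lintegral_mono_ae ?_
    filter_upwards [hLF, hLG] with x hx hy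
    have hx' : ‖F x‖ₑ ≤ L_F := enorm_le_coe.2 hx
    have hy' : ‖G x‖ₑ ≤ L_G := enorm_le_coe.2 hy
    calc _ ≤ ‖m x‖ₑ ^ p * ((‖F x‖ₑ * ‖f‖ₑ) * (‖g‖ₑ * ‖G x‖ₑ)) := by
          gcongr <;> exact enorm_inner_le _ _
      _ ≤ ‖m x‖ₑ ^ p * ((L_F * ‖f‖ₑ) * (‖g‖ₑ * L_G)) := by gcongr
      _ = _ := by ring
  refine (mul_le_mul_left h1 _).trans (le_of_eq ?_)
  rw [ENNReal.mul_rpow_of_nonneg _ _ hp0.le, multiplierBound_rpow hp,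
    ENNReal.mul_rpow_of_nonneg _ _ (by linarith : 0 ≤ p - 1)]
  have h2 : (‖f‖ₑ * ‖g‖ₑ) ^ p = (‖f‖ₑ * ‖g‖ₑ) * (‖f‖ₑ * ‖g‖ₑ) ^ (p - 1) := by
    conv_lhs => rw [← add_sub_cancel 1 p,
      ENNReal.rpow_add_of_nonneg _ _ zero_le_one (by linarith), ENNReal.rpow_one]
  rw [h2]
  ring

/-- The weights stay under the integral until they are summed over `i`, so the bound does not depend
on the size of the families. -/
theorem sum_rpow_lintegral_symbol_le (hF : IsBesselMap μ F B_F) (hG : IsBesselMap μ G B_G)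
    (hLF : IsNormBounded μ F L_F) (hLG : IsNormBounded μ G L_G)
    (hp : 1 ≤ p) (hm : AEStronglyMeasurable m μ) {ι : Type*} [Fintype ι] {e f : ι → H}
    (he : Orthonormal ℂ e) (hf : Orthonormal ℂ f) :
    ∑ i, (∫⁻ x, ‖m x‖ₑ * (‖inner ℂ (F x) (e i)‖ₑ * ‖inner ℂ (f i) (G x)‖ₑ) ∂μ) ^ p ≤
      multiplierBound μ m p B_F B_G L_F L_G ^ p := by
  have hen : ∀ {v : ι → H}, Orthonormal ℂ v → ∀ i, ‖v i‖ₑ = 1 := fun hv i => by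
    rw [← ofReal_norm, hv.1 i, ENNReal.ofReal_one]
  calc _ ≤ ∑ i, (∫⁻ x, ‖m x‖ₑ ^ p * (‖inner ℂ (F x) (e i)‖ₑ * ‖inner ℂ (f i) (G x)‖ₑ) ∂μ) *
        (((B_F : ℝ≥0∞) * B_G) ^ (1 / 2 : ℝ)) ^ (p - 1) := by
        refine Finset.sum_le_sum fun i _ => ?_
        simpa only [hen he i, hen hf i, mul_one] using
          rpow_lintegral_symbol_le hF hG hp hm (e i) (f i)
    _ = (∫⁻ x, ‖m x‖ₑ ^ p * ∑ i, (‖inner ℂ (F x) (e i)‖ₑ * ‖inner ℂ (f i) (G x)‖ₑ) ∂μ) *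
        (((B_F : ℝ≥0∞) * B_G) ^ (1 / 2 : ℝ)) ^ (p - 1) := by
        have hmeas : ∀ i, AEMeasurable (fun x => ‖m x‖ₑ ^ p *
            (‖inner ℂ (F x) (e i)‖ₑ * ‖inner ℂ (f i) (G x)‖ₑ)) μ := fun i =>
          (hm.enorm.pow_const p).mul (aemeasurable_weight hF hG (e i) (f i))
        simp only [Finset.mul_sum]
        rw [← Finset.sum_mul, lintegral_finsetSum' _ fun i _ => hmeas i]
    _ ≤ ((∫⁻ x, ‖m x‖ₑ ^ p ∂μ) * ((L_F : ℝ≥0∞) * L_G)) *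
        (((B_F : ℝ≥0∞) * B_G) ^ (1 / 2 : ℝ)) ^ (p - 1) := by
        gcongr
        rw [← lintegral_mul_const'' _ (hm.enorm.pow_const p)]
        refine lintegral_mono_ae ?_
        filter_upwards [hLF, hLG] with x hx hy
        have hx' : ‖F x‖ₑ ≤ L_F := enorm_le_coe.2 hx
        have hy' : ‖G x‖ₑ ≤ L_G := enorm_le_coe.2 hy
        exact mul_le_mul_right ((he.sum_enorm_inner_mul_le hf _ _).trans (mul_le_mul' hx' hy')) _
    _ = _ := (multiplierBound_rpow hp).symm

theorem integrable_symbol (hF : IsBesselMap μ F B_F) (hG : IsBesselMap μ G B_G)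
    (hLF : IsNormBounded μ F L_F) (hLG : IsNormBounded μ G L_G)
    (hp : 1 ≤ p) (hm : MemLp m (ENNReal.ofReal p) μ) (f g : H) :
    Integrable (fun x => m x * inner ℂ (F x) f * inner ℂ g (G x)) μ := by
  refine ⟨(hm.1.mul (hF.aemeasurable f).aestronglyMeasurable).mul
    (hG.aemeasurable_inner_left g).aestronglyMeasurable, ?_⟩
  simp only [HasFiniteIntegral, enorm_mul, mul_assoc]
  exact (lintegral_symbol_le hF hG hLF hLG hp hm.1 f g).trans_lt
    (ENNReal.mul_lt_top (multiplierBound_ne_top hp hm).lt_top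
      (ENNReal.mul_lt_top enorm_lt_top enorm_lt_top))

theorem enorm_integral_symbol_le (f g : H) :
    ‖∫ x, m x * inner ℂ (F x) f * inner ℂ g (G x) ∂μ‖ₑ ≤
      ∫⁻ x, ‖m x‖ₑ * (‖inner ℂ (F x) f‖ₑ * ‖inner ℂ g (G x)‖ₑ) ∂μ := by
  refine (enorm_integral_le_lintegral_enorm _).trans (le_of_eq ?_)
  simp only [enorm_mul, mul_assoc]

/-- Riesz representation of a bounded sesquilinear form. -/
theorem exists_isMultiplier [CompleteSpace H] (hF : IsBesselMap μ F B_F)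
    (hG : IsBesselMap μ G B_G)
    (hLF : IsNormBounded μ F L_F) (hLG : IsNormBounded μ G L_G)
    (hp : 1 ≤ p) (hm : MemLp m (ENNReal.ofReal p) μ) :
    ∃ M : H →L[ℂ] H, IsMultiplier μ m F G M := by
  have hint := integrable_symbol hF hG hLF hLG hp hm
  -- The conjugate makes the form antilinear in `f` and linear in `g`, matching ⟪M f, g⟫; it is
  -- undone by `inner_conj_symm`.
  let B : H →ₗ⋆[ℂ] H →ₗ[ℂ] ℂ := LinearMap.mk₂'ₛₗ (starRingEnd ℂ) (RingHom.id ℂ)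
    (fun f g => starRingEnd ℂ (∫ x, m x * inner ℂ (F x) f * inner ℂ g (G x) ∂μ))
    (fun f f' g => by
      simp only [inner_add_right, mul_add, add_mul]
      rw [integral_add (hint f g) (hint f' g), map_add])
    (fun c f g => by
      rw [smul_eq_mul, ← map_mul, ← integral_const_mul]
      simp only [inner_smul_right]
      congr 2 with x
      ring)
    (fun f g g' => by
      simp only [inner_add_left, mul_add]
      rw [integral_add (hint f g) (hint f g'), map_add])
    (fun c f g => by
      rw [RingHom.id_apply, smul_eq_mul]
      conv_rhs => rw [← Complex.conj_conj c]
      rw [← map_mul, ← integral_const_mul]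
      simp only [inner_smul_left]
      congr 2 with x
      ring)
  have hB : ∀ f g, ‖B f g‖ ≤ (multiplierBound μ m p B_F B_G L_F L_G).toReal * ‖f‖ * ‖g‖ := by
    intro f g
    have h1 := (enorm_integral_symbol_le (μ := μ) (m := m) (F := F) (G := G) f g).trans
      (lintegral_symbol_le hF hG hLF hLG hp hm.1 f g)
    have h2 := ENNReal.toReal_mono (ENNReal.mul_ne_top (multiplierBound_ne_top hp hm)
      (ENNReal.mul_ne_top enorm_ne_top enorm_ne_top)) h1
    simpa [B, mul_assoc] using h2
  refine ⟨InnerProductSpace.continuousLinearMapOfBilin (B.mkContinuous₂ _ hB), hint,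
    fun f g => ?_⟩
  rw [← inner_conj_symm, InnerProductSpace.continuousLinearMapOfBilin_apply]
  simp [B]

/-- A multiplier of norm bounded Bessel mappings with symbol in `L^p` exists, is unique and lies in
the Schatten class `S_p`, with the bound of `multiplierBound`. -/
theorem exists_multiplier_memSchatten [CompleteSpace H] (hF : IsBesselMap μ F B_F)
    (hG : IsBesselMap μ G B_G)
    (hLF : IsNormBounded μ F L_F) (hLG : IsNormBounded μ G L_G)
    (hp : 1 ≤ p) (hm : MemLp m (ENNReal.ofReal p) μ) :
    ∃ M : H →L[ℂ] H, IsMultiplier μ m F G M ∧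
      (∀ T : H → H, IsMultiplier μ m F G T → T = M) ∧ MemSchatten p M ∧
      schattenNorm p M ≤ multiplierBound μ m p B_F B_G L_F L_G := by
  obtain ⟨M, hM⟩ := exists_isMultiplier hF hG hLF hLG hp hm
  have hp0 : 0 < p := by linarith
  have hK := multiplierBound_ne_top (B_F := B_F) (B_G := B_G) (L_F := L_F) (L_G := L_G) hp hm
  have hsum : ∀ (ι : Type) [Fintype ι] (e f : ι → H), Orthonormal ℂ e → Orthonormal ℂ f →
      ∑ i, ‖inner ℂ (f i) (M (e i))‖ₑ ^ p ≤ multiplierBound μ m p B_F B_G L_F L_G ^ p := by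
    intro ι _ e f he hf
    refine le_trans (Finset.sum_le_sum fun i _ => ?_)
      (sum_rpow_lintegral_symbol_le hF hG hLF hLG hp hm.1 he hf)
    rw [hM.inner_eq]
    exact ENNReal.rpow_le_rpow (enorm_integral_symbol_le _ _) hp0.le
  have hnorm := schattenNorm_le_of_sum_enorm_inner_rpow_le hp0 hK hsum
  refine ⟨M, hM, fun T hT => funext fun f => ext_inner_left ℂ fun g => ?_,
    ⟨isCompactOperator_of_sum_enorm_inner_rpow_le hp0 hK hsum, hnorm.trans_lt hK.lt_top⟩, hnorm⟩
  rw [hT.inner_eq, hM.inner_eq]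

end BesselMultiplier

theorem theorem5p5
    {H₁ H₂ X₁ X₂ : Type*}
    [NormedAddCommGroup H₁] [InnerProductSpace ℂ H₁] [CompleteSpace H₁]
    [NormedAddCommGroup H₂] [InnerProductSpace ℂ H₂] [CompleteSpace H₂]
    [MeasurableSpace X₁] [MeasurableSpace X₂]
    (μ₁ : Measure X₁) (μ₂ : Measure X₂) [SigmaFinite μ₁] [SigmaFinite μ₂]
    (F G : X₁ × X₂ → HilbertTensor H₁ H₂) (B_F B_G L_F L_G : ℝ≥0)
    (hF : IsBesselMap (μ₁.prod μ₂) F B_F) (hG : IsBesselMap (μ₁.prod μ₂) G B_G)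
    (hLF : IsNormBounded (μ₁.prod μ₂) F L_F) (hLG : IsNormBounded (μ₁.prod μ₂) G L_G)
    (m : X₁ × X₂ → ℂ) :
    (MemLp m 1 (μ₁.prod μ₂) →
      ∃ M : HilbertTensor H₁ H₂ →L[ℂ] HilbertTensor H₁ H₂,
        IsMultiplier (μ₁.prod μ₂) m F G M ∧
        (∀ T : HilbertTensor H₁ H₂ → HilbertTensor H₁ H₂,
          IsMultiplier (μ₁.prod μ₂) m F G T → T = M) ∧
        IsTraceClass M ∧
        schattenNorm 1 M ≤ eLpNorm m 1 (μ₁.prod μ₂) * (L_F : ℝ≥0∞) * (L_G : ℝ≥0∞)) ∧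
    (∀ p : ℝ, 1 < p → MemLp m (ENNReal.ofReal p) (μ₁.prod μ₂) →
      ∃ M : HilbertTensor H₁ H₂ →L[ℂ] HilbertTensor H₁ H₂,
        IsMultiplier (μ₁.prod μ₂) m F G M ∧
        (∀ T : HilbertTensor H₁ H₂ → HilbertTensor H₁ H₂,
          IsMultiplier (μ₁.prod μ₂) m F G T → T = M) ∧
        MemSchatten p M ∧
        schattenNorm p M ≤ eLpNorm m (ENNReal.ofReal p) (μ₁.prod μ₂) *
          ((L_F : ℝ≥0∞) * (L_G : ℝ≥0∞)) ^ (1 / p) *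
          ((B_F : ℝ≥0∞) * (B_G : ℝ≥0∞)) ^ ((p - 1) / (2 * p))) := by
  refine ⟨fun hm => ?_, fun p hp hm =>
    exists_multiplier_memSchatten hF hG hLF hLG hp.le hm⟩
  obtain ⟨M, hM, huniq, hmem, hle⟩ := exists_multiplier_memSchatten hF hG hLF hLG le_rfl
    (by simpa using hm)
  refine ⟨M, hM, huniq, hmem, hle.trans (le_of_eq ?_)⟩
  -- At p = 1 the Bessel factor has exponent 0 and equals 1, even if a Bessel bound is 0.
  simp [multiplierBound, mul_assoc]
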